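/- An MV-algebra is an algebra $(A,\oplus,{}^*,0)$ such that $(A,\oplus,0)$ is a commutative monoid and, for all $x,y\in A$, $x^{**}=x$, $x\oplus 0^*=0^*$ and $(x^*\oplus y)^*\oplus y=(y^*\oplus x)^*\oplus x$. Put $1=0^*$, $x\odot y=(x^*\oplus y^*)^*$, and write $x\le y$ if $x^*\oplus y=1$. An ideal of $A$ is a subset containing $0$, closed under $\oplus$ and downward closed for $\le$; it is proper if it is not $A$. For an ideal $I$, the quotient MV-algebra $A/I$ is the quotient of $A$ by the congruence $x\equiv_I y\iff (x\odot y^*)\oplus(y\odot x^*)\in I$. For a proper ideal $I$, $\Gamma_I(A)$ is the simple graph with vertex set $\{x\in A\setminus I : x\odot y\in I \text{ for some } y\in A\setminus I\}$ in which distinct vertices $x,y$ are adjacent if and only if $x\odot y\in I$. The girth $\operatorname{gr}(\Gamma)$ of a graph $\Gamma$ is the length of a shortest cycle, and $\infty$ if $\Gamma$ has no cycles. For $n\ge 2$ let $L_n=\{0,\frac1{n-1},\dots,\frac{n-2}{n-1},1\}$ with $x\oplus y=\min\{1,x+y\}$ and $x^*=1-x$, and let $B_4$ be the four-element Boolean algebra,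 regarded as an MV-algebra with $\oplus=\vee$ and ${}^*$ the complement. Theorem. Let $A$ be an MV-algebra and let $I\neq\{0\}$ be a proper ideal of $A$ with $|A/I|\ge 3$. Then $$\operatorname{gr}(\Gamma_I(A))=\begin{cases}\infty, & \text{if there is an isomorphism } A\cong L_2\times L_3 \text{ carrying } I \text{ onto } L_2\times\{0\};\\ 4, & \text{if } A/I\cong B_4;\\ 3, & \text{otherwise.}\end{cases}$$ -/

import Mathlib

universe u v

/-- An MV-algebra: an algebra `(A, ⊕, *, 0)` of type `(2, 1, 0)` such that `(A, ⊕, 0)` is a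
commutative monoid, `x** = x`, `x ⊕ 0* = 0*` and `(x* ⊕ y)* ⊕ y = (y* ⊕ x)* ⊕ x`. -/
class MVAlgebra (A : Type u) where
  oplus : A → A → A
  neg : A → A
  zero : A
  oplus_assoc : ∀ x y z : A, oplus (oplus x y) z = oplus x (oplus y z)
  oplus_comm : ∀ x y : A, oplus x y = oplus y x
  oplus_zero : ∀ x : A, oplus x zero = x
  neg_neg : ∀ x : A, neg (neg x) = x
  oplus_neg_zero : ∀ x : A, oplus x (neg zero) = neg zero
  neg_oplus_oplus : ∀ x y : A,
    oplus (neg (oplus (neg x) y)) y = oplus (neg (oplus (neg y) x)) x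

infixl:65 " ⊕ₘ " => MVAlgebra.oplus
prefix:max "∼ₘ" => MVAlgebra.neg

namespace MVAlgebra

section Basic

variable {A : Type u} [MVAlgebra A]

/-- The constant `1 = 0*`. -/
def one : A := ∼ₘ(zero : A)

/-- `x ⊙ y = (x* ⊕ y*)*`. -/
def odot (x y : A) : A := ∼ₘ(∼ₘx ⊕ₘ ∼ₘy)

/-- The natural order: `x ≤ y` means `x* ⊕ y = 1`. -/
def le (x y : A) : Prop := ∼ₘx ⊕ₘ y = one

/-- The distance function `d(x, y) = (x ⊙ y*) ⊕ (y ⊙ x*)`. -/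
def dist (x y : A) : A := odot x ∼ₘy ⊕ₘ odot y ∼ₘx

instance : Std.Associative (MVAlgebra.oplus : A → A → A) := ⟨oplus_assoc⟩
instance : Std.Commutative (MVAlgebra.oplus : A → A → A) := ⟨oplus_comm⟩

theorem neg_oplus_self (x : A) : ∼ₘx ⊕ₘ x = one := by
  have h := neg_oplus_oplus x (one : A)
  unfold one at *
  rw [oplus_neg_zero, neg_neg, oplus_comm zero x, oplus_zero] at h
  exact h.symm

theorem odot_neg (x y : A) : odot x ∼ₘy = ∼ₘ(∼ₘx ⊕ₘ y) := by
  simp only [odot, neg_neg]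

theorem le_oplus (x z : A) : le x (x ⊕ₘ z) := by
  unfold le
  rw [← oplus_assoc, neg_oplus_self, oplus_comm]
  exact oplus_neg_zero z

theorem le_iff {x y : A} : le x y ↔ ∃ z, x ⊕ₘ z = y := by
  constructor
  · intro h
    refine ⟨∼ₘ(∼ₘy ⊕ₘ x), ?_⟩
    have h' := neg_oplus_oplus x y
    unfold le at h
    rw [h, one, neg_neg, oplus_comm zero y, oplus_zero] at h'
    rw [oplus_comm, ← h']
  · rintro ⟨z, rfl⟩
    exact le_oplus x z

theorem le_trans {x y z : A} (h₁ : le x y) (h₂ : le y z) : le x z := by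
  obtain ⟨a, rfl⟩ := le_iff.1 h₁
  obtain ⟨b, rfl⟩ := le_iff.1 h₂
  rw [oplus_assoc]
  exact le_oplus _ _

theorem oplus_le_oplus {x y u v : A} (h₁ : le x y) (h₂ : le u v) :
    le (x ⊕ₘ u) (y ⊕ₘ v) := by
  obtain ⟨a, rfl⟩ := le_iff.1 h₁
  obtain ⟨b, rfl⟩ := le_iff.1 h₂
  exact le_iff.2 ⟨a ⊕ₘ b, by ac_rfl⟩

theorem odot_neg_le_iff {x y z : A} : le (odot x ∼ₘy) z ↔ le x (y ⊕ₘ z) := by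
  rw [odot_neg, le, le, neg_neg, oplus_assoc]

theorem le_oplus_odot_neg (x y : A) : le x (y ⊕ₘ odot x ∼ₘy) :=
  odot_neg_le_iff.1 (by have := le_oplus (odot x ∼ₘy) zero; rwa [oplus_zero] at this)

theorem odot_neg_triangle (x y z : A) :
    le (odot x ∼ₘz) (odot x ∼ₘy ⊕ₘ odot y ∼ₘz) := by
  rw [odot_neg_le_iff]
  refine le_trans (le_oplus_odot_neg x y) ?_
  have h := oplus_le_oplus (le_oplus_odot_neg y z) (neg_oplus_self (odot x ∼ₘy))
  have e : z ⊕ₘ (odot x ∼ₘy ⊕ₘ odot y ∼ₘz) = z ⊕ₘ odot y ∼ₘz ⊕ₘ odot x ∼ₘy := by ac_rfl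
  rw [e]
  exact h

theorem odot_neg_oplus (x y u v : A) :
    le (odot (x ⊕ₘ u) ∼ₘ(y ⊕ₘ v)) (odot x ∼ₘy ⊕ₘ odot u ∼ₘv) := by
  rw [odot_neg_le_iff]
  have h := oplus_le_oplus (le_oplus_odot_neg x y) (le_oplus_odot_neg u v)
  have e : y ⊕ₘ v ⊕ₘ (odot x ∼ₘy ⊕ₘ odot u ∼ₘv) =
      y ⊕ₘ odot x ∼ₘy ⊕ₘ (v ⊕ₘ odot u ∼ₘv) := by ac_rfl
  rw [e]
  exact h

end Basic

/-- The direct product of two MV-algebras, with componentwise operations. -/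
instance instProd {A : Type u} {B : Type v} [MVAlgebra A] [MVAlgebra B] :
    MVAlgebra (A × B) where
  oplus x y := (x.1 ⊕ₘ y.1, x.2 ⊕ₘ y.2)
  neg x := (∼ₘx.1, ∼ₘx.2)
  zero := (zero, zero)
  oplus_assoc _ _ _ := Prod.ext (oplus_assoc _ _ _) (oplus_assoc _ _ _)
  oplus_comm _ _ := Prod.ext (oplus_comm _ _) (oplus_comm _ _)
  oplus_zero _ := Prod.ext (oplus_zero _) (oplus_zero _)
  neg_neg _ := Prod.ext (neg_neg _) (neg_neg _)
  oplus_neg_zero _ := Prod.ext (oplus_neg_zero _) (oplus_neg_zero _)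
  neg_oplus_oplus _ _ := Prod.ext (neg_oplus_oplus _ _) (neg_oplus_oplus _ _)

/-- The MV-algebra `(A, ∨, -, 0)` of a Boolean algebra. -/
abbrev ofBooleanAlgebra (A : Type u) [BooleanAlgebra A] : MVAlgebra A where
  oplus x y := x ⊔ y
  neg x := xᶜ
  zero := ⊥
  oplus_assoc := sup_assoc
  oplus_comm := sup_comm
  oplus_zero := sup_bot_eq
  neg_neg := compl_compl
  oplus_neg_zero x := by simp
  neg_oplus_oplus x y := by
    rw [compl_sup, compl_sup, compl_compl, compl_compl, sup_inf_right, sup_inf_right,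
      compl_sup_eq_top, compl_sup_eq_top, inf_top_eq, inf_top_eq, sup_comm]

/-- The standard MV-algebra on the real unit interval:
`x ⊕ y = min {1, x + y}` and `x* = 1 - x`. -/
noncomputable instance instUnitInterval : MVAlgebra unitInterval where
  oplus x y := ⟨min 1 ((x : ℝ) + y),
    le_min zero_le_one (add_nonneg x.2.1 y.2.1), min_le_left _ _⟩
  neg x := ⟨1 - (x : ℝ), sub_nonneg.2 x.2.2, sub_le_self _ x.2.1⟩
  zero := ⟨0, le_rfl, zero_le_one⟩
  oplus_assoc x y z := by
    apply Subtype.ext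
    have := x.2.1
    have := z.2.1
    simp only
    grind
  oplus_comm x y := by
    apply Subtype.ext
    simp only [add_comm]
  oplus_zero x := by
    apply Subtype.ext
    have := x.2.2
    simp only
    grind
  neg_neg x := by
    apply Subtype.ext
    simp only [sub_sub_cancel]
  oplus_neg_zero x := by
    apply Subtype.ext
    have := x.2.1
    simp only
    grind
  neg_oplus_oplus x y := by
    apply Subtype.ext
    have := x.2.1
    have := x.2.2
    have := y.2.1
    have := y.2.2
    simp only
    grind

end MVAlgebra

section

open MVAlgebra

/-- The carrier `{0, 1/(n-1), …, (n-2)/(n-1), 1}` of the `n`-element MV-chain (`n ≥ 2`). -/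
def MVChain (n : ℕ) [n.AtLeastTwo] : Type :=
  {x : unitInterval // ∃ k : ℕ, k < n ∧ (x : ℝ) = (k : ℝ) / ((n : ℝ) - 1)}

/-- The MV-algebra `L_n`, a subalgebra of the unit interval. -/
noncomputable instance MVChain.instMVAlgebra (n : ℕ) [hn : n.AtLeastTwo] :
    MVAlgebra (MVChain n) where
  oplus x y := ⟨x.1 ⊕ₘ y.1, by
    obtain ⟨⟨x, hx⟩, a, ha, hxa⟩ := x
    obtain ⟨⟨y, hy⟩, b, hb, hyb⟩ := y
    have h2 : (2 : ℝ) ≤ n := by exact_mod_cast hn.prop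
    have h1 : (n : ℝ) - 1 ≠ 0 := by linarith
    have h0 : 2 ≤ n := hn.prop
    simp only at hxa hyb
    rcases le_total (n - 1) (a + b) with h | h
    · refine ⟨n - 1, by omega, ?_⟩
      have h' : (n : ℝ) - 1 ≤ a + b := by
        have : n ≤ a + b + 1 := by omega
        have : (n : ℝ) ≤ a + b + 1 := by exact_mod_cast this
        linarith
      change min 1 (x + y) = _
      rw [Nat.cast_sub (by omega), Nat.cast_one, div_self h1, hxa, hyb, ← add_div]
      exact min_eq_left ((one_le_div (by linarith)).2 h')
    · refine ⟨a + b, by omega, ?_⟩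
      have h' : (a : ℝ) + b ≤ n - 1 := by
        have : a + b + 1 ≤ n := by omega
        have : (a : ℝ) + b + 1 ≤ n := by exact_mod_cast this
        linarith
      change min 1 (x + y) = _
      rw [Nat.cast_add, hxa, hyb, ← add_div]
      exact min_eq_right ((div_le_one (by linarith)).2 h')⟩
  neg x := ⟨∼ₘx.1, by
    obtain ⟨⟨x, hx⟩, a, ha, hxa⟩ := x
    have h2 : (2 : ℝ) ≤ n := by exact_mod_cast hn.prop
    have h1 : (n : ℝ) - 1 ≠ 0 := by linarith
    have h0 : 2 ≤ n := hn.prop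
    simp only at hxa
    refine ⟨n - 1 - a, by omega, ?_⟩
    change 1 - x = _
    rw [Nat.cast_sub (by omega), Nat.cast_sub (by omega), Nat.cast_one, hxa, sub_div,
      div_self h1]⟩
  zero := ⟨zero, 0, by have := hn.prop; omega, by
    change (0 : ℝ) = _
    simp⟩
  oplus_assoc _ _ _ := Subtype.ext (oplus_assoc _ _ _)
  oplus_comm _ _ := Subtype.ext (oplus_comm _ _)
  oplus_zero _ := Subtype.ext (oplus_zero _)
  neg_neg _ := Subtype.ext (neg_neg _)
  oplus_neg_zero _ := Subtype.ext (oplus_neg_zero _)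
  neg_oplus_oplus _ _ := Subtype.ext (neg_oplus_oplus _ _)

/-- The four-element Boolean algebra. -/
def BooleanFour : Type := Bool × Bool

instance BooleanFour.instMVAlgebra : MVAlgebra BooleanFour :=
  MVAlgebra.ofBooleanAlgebra (Bool × Bool)

/-- Isomorphisms of MV-algebras. -/
structure MVEquiv (A : Type u) (B : Type v) [MVAlgebra A] [MVAlgebra B] extends A ≃ B where
  map_oplus' : ∀ x y : A, toFun (x ⊕ₘ y) = toFun x ⊕ₘ toFun y
  map_neg' : ∀ x : A, toFun ∼ₘx = ∼ₘ(toFun x)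
  map_zero' : toFun zero = zero

/-- Ideals of an MV-algebra: they contain `0`, are closed under `⊕`, and are downward closed. -/
structure MVIdeal (A : Type u) [MVAlgebra A] where
  carrier : Set A
  zero_mem' : zero ∈ carrier
  oplus_mem' : ∀ {a b : A}, a ∈ carrier → b ∈ carrier → a ⊕ₘ b ∈ carrier
  mem_of_le' : ∀ {a b : A}, b ∈ carrier → le a b → a ∈ carrier

namespace MVIdeal

variable {A : Type u} [MVAlgebra A]

instance : SetLike (MVIdeal A) A where
  coe := carrier
  coe_injective I J h := by
    cases I
    cases J
    congr

/-- An ideal is proper if it is not the whole algebra. -/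
def IsProper (I : MVIdeal A) : Prop := (I : Set A) ≠ Set.univ

theorem dist_mem_iff (I : MVIdeal A) {x y : A} :
    MVAlgebra.dist x y ∈ I ↔ odot x ∼ₘy ∈ I ∧ odot y ∼ₘx ∈ I := by
  refine ⟨fun h => ⟨I.mem_of_le' h (le_oplus _ _), I.mem_of_le' h ?_⟩,
    fun h => I.oplus_mem' h.1 h.2⟩
  rw [MVAlgebra.dist, oplus_comm]
  exact le_oplus _ _

/-- The congruence `x ≡ y` if and only if `d(x, y) ∈ I`. -/
def setoid (I : MVIdeal A) : Setoid A where
  r x y := MVAlgebra.dist x y ∈ I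
  iseqv := by
    constructor
    · intro x
      have h : odot x ∼ₘx = zero := by rw [odot_neg, neg_oplus_self, one, MVAlgebra.neg_neg]
      rw [dist_mem_iff, h]
      exact ⟨I.zero_mem', I.zero_mem'⟩
    · intro x y h
      rw [dist_mem_iff] at *
      exact h.symm
    · intro x y z h₁ h₂
      rw [dist_mem_iff] at *
      exact ⟨I.mem_of_le' (I.oplus_mem' h₁.1 h₂.1) (odot_neg_triangle x y z),
        I.mem_of_le' (I.oplus_mem' h₂.2 h₁.2) (odot_neg_triangle z y x)⟩

/-- The carrier of the quotient algebra `A / I`. -/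
def QuotientAlgebra (I : MVIdeal A) : Type u := Quotient I.setoid

/-- The quotient algebra `A / I`, with the operations induced by those of `A`. -/
instance instQuotientAlgebra (I : MVIdeal A) : MVAlgebra I.QuotientAlgebra where
  oplus := Quotient.map₂ (fun x y : A => x ⊕ₘ y) (by
    intro x y h u v h'
    change MVAlgebra.dist _ _ ∈ I at h h'
    change MVAlgebra.dist _ _ ∈ I
    rw [dist_mem_iff] at *
    exact ⟨I.mem_of_le' (I.oplus_mem' h.1 h'.1) (odot_neg_oplus x y u v),
      I.mem_of_le' (I.oplus_mem' h.2 h'.2) (odot_neg_oplus y x v u)⟩)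
  neg := Quotient.map (fun x : A => ∼ₘx) (by
    intro x y h
    change MVAlgebra.dist _ _ ∈ I at h
    change MVAlgebra.dist _ _ ∈ I
    rw [dist_mem_iff] at *
    simp only [odot, MVAlgebra.neg_neg] at *
    rw [oplus_comm x, oplus_comm y]
    exact h.symm)
  zero := Quotient.mk _ zero
  oplus_assoc := by
    rintro ⟨x⟩ ⟨y⟩ ⟨z⟩
    exact congrArg (Quotient.mk I.setoid) (oplus_assoc x y z)
  oplus_comm := by
    rintro ⟨x⟩ ⟨y⟩
    exact congrArg (Quotient.mk I.setoid) (oplus_comm x y)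
  oplus_zero := by
    rintro ⟨x⟩
    exact congrArg (Quotient.mk I.setoid) (oplus_zero x)
  neg_neg := by
    rintro ⟨x⟩
    exact congrArg (Quotient.mk I.setoid) (neg_neg x)
  oplus_neg_zero := by
    rintro ⟨x⟩
    exact congrArg (Quotient.mk I.setoid) (oplus_neg_zero x)
  neg_oplus_oplus := by
    rintro ⟨x⟩ ⟨y⟩
    exact congrArg (Quotient.mk I.setoid) (neg_oplus_oplus x y)

/-- The vertex set `{x ∈ A \ I | ∃ y ∈ A \ I, x ⊙ y ∈ I}`. -/
def zeroDivisorVertices (I : MVIdeal A) : Set A :=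
  {x | x ∉ I ∧ ∃ y, y ∉ I ∧ odot x y ∈ I}

/-- The ideal-based zero-divisor graph `Γ_I(A)`: distinct vertices `x` and `y` are adjacent
if and only if `x ⊙ y ∈ I`. -/
def zeroDivisorGraph (I : MVIdeal A) : SimpleGraph I.zeroDivisorVertices where
  Adj x y := x ≠ y ∧ odot (x : A) (y : A) ∈ I
  symm := ⟨fun x y h => ⟨h.1.symm, by
    have h2 := h.2
    rwa [odot, oplus_comm] at h2⟩⟩
  loopless := ⟨fun _ h => h.1 rfl⟩

end MVIdeal

end

/-! Adjacency in the graph is orthogonality of classes in `A / I`, so vertices are lifts of nonzero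
classes orthogonal to some nonzero class. Because `I` is nonzero, every class has at least two
elements (`exists_lt_of_quot_eq`), and these repeated lifts supply the short cycles.

If `A / I` is not Boolean, it has `u ≠ 0` with `u ⊙ u = 0`. Two lifts of `u` and a lift of any other
nonzero class orthogonal to `u` form a triangle. If there is no such class, `A / I` is `{0, u, 1}`
(`eq_of_annihilator_subset`); three lifts of `u` form a triangle, and if only two exist, the MV
identities recover all of `A` as `L₂ × L₃` (`exists_mvEquiv_of_class_eq_pair`). There the graph has
at most two vertices, hence no cycle.

If `A / I` is Boolean, three nonzero pairwise orthogonal classes lift to a triangle. Without them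
every element other than `0` and `1` is an atom, so `A / I` is `B₄` (`eq_of_no_orthogonal`). Over
`B₄` triangles are impossible, while two lifts of each atom form a 4-cycle. -/

namespace MVAlgebra

/-! ### Order, orthogonality and small MV-algebras. -/

section Order

variable {A : Type u} [MVAlgebra A]

theorem neg_zero_eq_one : ∼ₘ(zero : A) = one := rfl

theorem neg_one_eq_zero : ∼ₘ(one : A) = zero := MVAlgebra.neg_neg _

theorem zero_oplus (x : A) : zero ⊕ₘ x = x := by rw [oplus_comm, oplus_zero]

theorem oplus_one (x : A) : x ⊕ₘ one = one := oplus_neg_zero x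

theorem one_oplus (x : A) : one ⊕ₘ x = one := by rw [oplus_comm, oplus_one]

theorem oplus_neg_self (x : A) : x ⊕ₘ ∼ₘx = one := by rw [oplus_comm, neg_oplus_self]

theorem neg_inj {x y : A} (h : ∼ₘx = ∼ₘy) : x = y := by rw [← MVAlgebra.neg_neg x, h, MVAlgebra.neg_neg]

theorem le_refl (x : A) : le x x := neg_oplus_self x

theorem le_antisymm {x y : A} (h₁ : le x y) (h₂ : le y x) : x = y := by
  have h := neg_oplus_oplus x y
  unfold le at h₁ h₂
  rw [h₁, h₂, neg_one_eq_zero, zero_oplus, zero_oplus] at h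
  exact h.symm

theorem zero_le (x : A) : le zero x := one_oplus x

theorem eq_zero_of_le_zero {x : A} (h : le x zero) : x = zero := le_antisymm h (zero_le x)

theorem neg_le_neg {x y : A} (h : le x y) : le ∼ₘy ∼ₘx := by
  unfold le at *
  rwa [MVAlgebra.neg_neg, oplus_comm]

theorem odot_comm (x y : A) : odot x y = odot y x := by rw [odot, odot, oplus_comm]

theorem odot_eq_zero_iff {x y : A} : odot x y = zero ↔ le x ∼ₘy := by
  unfold odot le
  constructor
  · intro h
    rw [← MVAlgebra.neg_neg (∼ₘx ⊕ₘ ∼ₘy), h, neg_zero_eq_one]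
  · intro h
    rw [h, neg_one_eq_zero]

theorem odot_neg_eq_zero_iff {x y : A} : odot x ∼ₘy = zero ↔ le x y := by
  rw [odot_eq_zero_iff, MVAlgebra.neg_neg]

theorem odot_neg_self (x : A) : odot x ∼ₘx = zero := odot_neg_eq_zero_iff.2 (le_refl x)

theorem odot_le_left (x y : A) : le (odot x y) x := by
  have h := neg_le_neg (le_oplus ∼ₘx ∼ₘy)
  rwa [MVAlgebra.neg_neg] at h

theorem odot_le_right (x y : A) : le (odot x y) y := odot_comm x y ▸ odot_le_left y x

/-- Translation by a nonzero element moves `a` upwards or downwards. -/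
theorem eq_zero_of_oplus_eq_of_neg_oplus_eq {a j : A} (h₁ : a ⊕ₘ j = a)
    (h₂ : ∼ₘa ⊕ₘ j = ∼ₘa) : j = zero := by
  have hj : le j ∼ₘa := le_iff.2 ⟨∼ₘa, by rw [oplus_comm, h₂]⟩
  -- The two sides of this identity reduce to `1` (by `h₁`) and to `∼ₘj` (since `j ≤ ∼ₘa`).
  have h := neg_oplus_oplus ∼ₘj a
  unfold le at hj
  rw [MVAlgebra.neg_neg, oplus_comm j a, h₁, neg_oplus_self, oplus_comm ∼ₘa, hj, neg_one_eq_zero, zero_oplus] at h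
  rw [← MVAlgebra.neg_neg j, ← h, neg_one_eq_zero]

theorem neg_oplus_neg_self_of_oplus_self {x : A} (h : x ⊕ₘ x = x) : ∼ₘx ⊕ₘ ∼ₘx = ∼ₘx := by
  refine le_antisymm ?_ (le_oplus _ _)
  have := neg_oplus_oplus x ∼ₘx
  rw [MVAlgebra.neg_neg, h, neg_oplus_self] at this
  exact this

/-- An algebra that is not Boolean has a nonzero element with square zero. -/
theorem exists_ne_zero_odot_self_eq_zero {x : A} (h : x ⊕ₘ x ≠ x) :
    ∃ u : A, u ≠ zero ∧ odot u u = zero := by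
  -- This `u` lies below `x` by residuation and below `∼ₘx` as a product, so `u ≤ x ≤ ∼ₘu`.
  refine ⟨odot (x ⊕ₘ x) ∼ₘx, fun h0 => h ?_, odot_eq_zero_iff.2 ?_⟩
  · exact le_antisymm (odot_neg_eq_zero_iff.1 h0) (le_oplus _ _)
  · exact le_trans (odot_neg_le_iff.2 (le_refl _))
      (by have := neg_le_neg (odot_le_right (x ⊕ₘ x) ∼ₘx); rwa [MVAlgebra.neg_neg] at this)

/-- If the only nonzero annihilator of the square-zero element `u` is `u` itself, then the
algebra is the three-element chain `{0, u, 1}`. -/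
theorem eq_of_annihilator_subset {u : A} (hu : u ≠ zero) (huu : odot u u = zero)
    (h : ∀ y : A, odot u y = zero → y = zero ∨ y = u) :
    ∼ₘu = u ∧ ∀ x : A, x = zero ∨ x = u ∨ x = one := by
  have hn : ∼ₘu = u := by
    refine (h _ (odot_neg_self u)).resolve_left fun h0 => hu ?_
    have := odot_eq_zero_iff.1 huu
    rw [h0] at this
    exact eq_zero_of_le_zero this
  have hle : ∀ y : A, le y u → y = zero ∨ y = u := fun y hy =>
    h y (by rw [odot_comm, odot_eq_zero_iff, hn]; exact hy)
  refine ⟨hn, fun x => ?_⟩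
  -- The value `0` puts `x` below `∼ₘu = u`; the value `u` puts `u` below `x`, hence `∼ₘx` below
  -- `u`.
  rcases hle (odot x u) (odot_le_right x u) with h' | h'
  · rw [odot_eq_zero_iff, hn] at h'
    exact (hle x h').imp_right Or.inl
  · have hx := neg_le_neg (h' ▸ odot_le_left x u : le u x)
    rw [hn] at hx
    rcases hle _ hx with h'' | h''
    · exact Or.inr (Or.inr (by rw [← MVAlgebra.neg_neg x, h'', neg_zero_eq_one]))
    · exact Or.inr (Or.inl (by rw [← MVAlgebra.neg_neg x, h'', hn]))

/-- If an algebra has no three nonzero pairwise orthogonal elements, then any nonzero element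
with nonzero complement is an atom. -/
theorem eq_zero_or_eq_of_le_of_no_orthogonal
    (h : ¬∃ x y z : A, x ≠ zero ∧ y ≠ zero ∧ z ≠ zero ∧
      odot x y = zero ∧ odot y z = zero ∧ odot x z = zero)
    {a v : A} (ha : a ≠ one) (hv : le v a) : v = zero ∨ v = a := by
  by_contra! hc
  -- An element strictly between `0` and `a` splits `1` into three orthogonal pieces.
  refine h ⟨v, odot a ∼ₘv, ∼ₘa, hc.1, fun h0 => hc.2 ?_, fun h0 => ha ?_, ?_, ?_, ?_⟩
  · exact le_antisymm hv (odot_neg_eq_zero_iff.1 h0)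
  · rw [← MVAlgebra.neg_neg a, h0, neg_zero_eq_one]
  · rw [odot_comm, odot_eq_zero_iff]
    exact odot_le_right _ _
  · rw [odot_neg_eq_zero_iff]
    exact odot_le_left _ _
  · rw [odot_neg_eq_zero_iff]
    exact hv

/-- Both `a` and `∼ₘa` are atoms, so `x ⊙ a` is `0` or `a`. Then either `x` or `∼ₘx` lies below the
atom `∼ₘa`. -/
theorem eq_of_no_orthogonal
    (h : ¬∃ x y z : A, x ≠ zero ∧ y ≠ zero ∧ z ≠ zero ∧
      odot x y = zero ∧ odot y z = zero ∧ odot x z = zero)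
    {a : A} (ha0 : a ≠ zero) (ha1 : a ≠ one) (x : A) :
    x = zero ∨ x = a ∨ x = ∼ₘa ∨ x = one := by
  have hn1 : ∼ₘa ≠ one := fun h' => ha0 (by rw [← MVAlgebra.neg_neg a, h', neg_one_eq_zero])
  rcases eq_zero_or_eq_of_le_of_no_orthogonal h ha1 (odot_le_right x a) with h' | h'
  · rw [odot_eq_zero_iff] at h'
    rcases eq_zero_or_eq_of_le_of_no_orthogonal h hn1 h' with h'' | h'' <;> simp [h'']
  · have hx := neg_le_neg (h' ▸ odot_le_left x a : le a x)
    rcases eq_zero_or_eq_of_le_of_no_orthogonal h hn1 hx with h'' | h''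
    · have : x = one := by rw [← MVAlgebra.neg_neg x, h'', neg_zero_eq_one]
      simp [this]
    · simp [neg_inj h'']

end Order

end MVAlgebra

/-! ### The four-element Boolean algebra. -/

section Boolean

open MVAlgebra

/-- The inverse of a bijective homomorphism. -/
noncomputable def MVEquiv.ofBijectiveSymm {A : Type u} {B : Type v} [MVAlgebra A] [MVAlgebra B]
    (g : B → A) (hg : Function.Bijective g) (hplus : ∀ p q : B, g (p ⊕ₘ q) = g p ⊕ₘ g q)
    (hneg : ∀ p : B, g ∼ₘp = ∼ₘ(g p)) (hzero : g zero = zero) : MVEquiv A B where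
  toEquiv := (Equiv.ofBijective g hg).symm
  map_oplus' x y := by
    obtain ⟨p, rfl⟩ := hg.2 x
    obtain ⟨q, rfl⟩ := hg.2 y
    change (Equiv.ofBijective g hg).symm _ =
      (Equiv.ofBijective g hg).symm _ ⊕ₘ (Equiv.ofBijective g hg).symm _
    rw [← hplus, Equiv.ofBijective_symm_apply_apply, Equiv.ofBijective_symm_apply_apply,
      Equiv.ofBijective_symm_apply_apply]
  map_neg' x := by
    obtain ⟨p, rfl⟩ := hg.2 x
    change (Equiv.ofBijective g hg).symm _ = ∼ₘ((Equiv.ofBijective g hg).symm _)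
    rw [← hneg, Equiv.ofBijective_symm_apply_apply, Equiv.ofBijective_symm_apply_apply]
  map_zero' := by
    change (Equiv.ofBijective g hg).symm _ = _
    rw [← hzero, Equiv.ofBijective_symm_apply_apply]

namespace BooleanFour

theorem exists_coords (p : BooleanFour) : ∃ s t : Bool, p = (s, t) := ⟨p.1, p.2, rfl⟩

theorem oplus_mk (s t s' t' : Bool) :
    MVAlgebra.oplus (A := BooleanFour) (s, t) (s', t') = ((s || s'), (t || t')) := rfl

theorem neg_mk (s t : Bool) : MVAlgebra.neg (A := BooleanFour) (s, t) = (!s, !t) := rfl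

theorem zero_eq : (zero : BooleanFour) = (false, false) := rfl

theorem odot_mk (s t s' t' : Bool) :
    odot (A := BooleanFour) (s, t) (s', t') = ((s && s'), (t && t')) := by
  simp only [odot, neg_mk, oplus_mk, Bool.not_or, Bool.not_not]
  rfl

/-- A two-point set does not contain three disjoint nonempty subsets. -/
theorem no_orthogonal_triple {p q r : BooleanFour} (hp : p ≠ zero) (hq : q ≠ zero)
    (hr : r ≠ zero) (hpq : odot p q = zero) (hqr : odot q r = zero) (hpr : odot p r = zero) :
    False := by
  obtain ⟨s, t, rfl⟩ := exists_coords p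
  obtain ⟨s', t', rfl⟩ := exists_coords q
  obtain ⟨s'', t'', rfl⟩ := exists_coords r
  rw [odot_mk, zero_eq] at hpq hqr hpr
  rw [zero_eq] at hp hq hr
  have key : ∀ s t s' t' s'' t'' : Bool, (s, t) ≠ (false, false) → (s', t') ≠ (false, false) →
      (s'', t'') ≠ (false, false) → ((s && s'), (t && t')) = (false, false) →
      ((s' && s''), (t' && t'')) = (false, false) →
      ((s && s''), (t && t'')) = (false, false) → False := by decide
  exact key s t s' t' s'' t'' hp hq hr hpq hqr hpr

end BooleanFour

/-- A four-element algebra with idempotent addition is `B₄`. -/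
theorem nonempty_mvEquiv_booleanFour {A : Type u} [MVAlgebra A] {a : A} (ha0 : a ≠ zero)
    (ha1 : a ≠ one) (hb : ∀ x : A, x ⊕ₘ x = x)
    (h : ∀ x : A, x = zero ∨ x = a ∨ x = ∼ₘa ∨ x = one) :
    Nonempty (MVEquiv A BooleanFour) := by
  have hn0 : ∼ₘa ≠ zero := fun h' => ha1 (by rw [← MVAlgebra.neg_neg a, h', neg_zero_eq_one])
  have hn1 : ∼ₘa ≠ one := fun h' => ha0 (by rw [← MVAlgebra.neg_neg a, h', neg_one_eq_zero])
  -- Idempotence rules out the three-element chain: `a = ∼ₘa` would give `a = a ⊕ₘ a = 1`.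
  have han : a ≠ ∼ₘa := fun h' => ha1 (by rw [← hb a]; nth_rw 2 [h']; exact oplus_neg_self a)
  have h01 : (zero : A) ≠ one := fun h' => ha0 (by rw [← zero_oplus a, h', one_oplus])
  let g : BooleanFour → A := fun p =>
    match p with
    | (false, false) => zero
    | (true, false) => a
    | (false, true) => ∼ₘa
    | (true, true) => one
  have hg : Function.Bijective g := by
    constructor
    · rintro ⟨_ | _, _ | _⟩ ⟨_ | _, _ | _⟩ hpq <;>
        first
        | rfl
        | exact absurd hpq (by simp [g, ha0, ha1, hn0, hn1, han, h01, ha0.symm, ha1.symm,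
            hn0.symm, hn1.symm, han.symm, h01.symm])
    · intro x
      rcases h x with rfl | rfl | rfl | rfl
      exacts [⟨(false, false), rfl⟩, ⟨(true, false), rfl⟩, ⟨(false, true), rfl⟩,
        ⟨(true, true), rfl⟩]
  have hplus : ∀ p q : BooleanFour, g (p ⊕ₘ q) = g p ⊕ₘ g q := by
    rintro ⟨_ | _, _ | _⟩ ⟨_ | _, _ | _⟩ <;> rw [BooleanFour.oplus_mk] <;>
      simp [g, hb, zero_oplus, oplus_zero, one_oplus, oplus_one, neg_oplus_self, oplus_neg_self]
  have hneg : ∀ p : BooleanFour, g ∼ₘp = ∼ₘ(g p) := by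
    rintro ⟨_ | _, _ | _⟩ <;> rw [BooleanFour.neg_mk] <;>
      simp [g, neg_zero_eq_one, neg_one_eq_zero, MVAlgebra.neg_neg]
  exact ⟨MVEquiv.ofBijectiveSymm g hg hplus hneg rfl⟩

end Boolean

/-! ### The chains `L₂`, `L₃` and their product. -/

section Chains

open MVAlgebra

namespace MVChain

theorem coe_zero (n : ℕ) [n.AtLeastTwo] : (((zero : MVChain n).1 : unitInterval) : ℝ) = 0 := rfl

theorem coe_one (n : ℕ) [n.AtLeastTwo] : (((one : MVChain n).1 : unitInterval) : ℝ) = 1 :=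
  sub_zero 1

theorem coe_oplus {n : ℕ} [n.AtLeastTwo] (x y : MVChain n) :
    (((x ⊕ₘ y).1 : unitInterval) : ℝ) = min 1 ((x.1 : ℝ) + y.1) := rfl

theorem coe_neg {n : ℕ} [n.AtLeastTwo] (x : MVChain n) :
    (((∼ₘx).1 : unitInterval) : ℝ) = 1 - (x.1 : ℝ) := rfl

theorem ext {n : ℕ} [n.AtLeastTwo] {x y : MVChain n} (h : (x.1 : ℝ) = y.1) : x = y :=
  Subtype.ext (Subtype.ext h)

theorem zero_ne_one (n : ℕ) [n.AtLeastTwo] : (zero : MVChain n) ≠ one := fun h => by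
  have := congrArg (fun x : MVChain n => (x.1 : ℝ)) h
  simp only [coe_zero, coe_one] at this
  exact _root_.zero_ne_one this

theorem eq_zero_or_eq_one (x : MVChain 2) : x = zero ∨ x = one := by
  obtain ⟨k, hk, hx⟩ := x.2
  interval_cases k
  · exact Or.inl (ext (by rw [hx, coe_zero]; norm_num))
  · exact Or.inr (ext (by rw [hx, coe_one]; norm_num))

/-- The middle element `1/2` of the three-element chain. -/
noncomputable def half : MVChain 3 :=
  ⟨⟨1 / 2, by norm_num, by norm_num⟩, 1, by norm_num, by norm_num⟩

theorem coe_half : ((half.1 : unitInterval) : ℝ) = 1 / 2 := rfl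

theorem eq_zero_or_half_or_one (x : MVChain 3) : x = zero ∨ x = half ∨ x = one := by
  obtain ⟨k, hk, hx⟩ := x.2
  interval_cases k
  · exact Or.inl (ext (by rw [hx, coe_zero]; norm_num))
  · exact Or.inr (Or.inl (ext (by rw [hx, coe_half]; norm_num)))
  · exact Or.inr (Or.inr (ext (by rw [hx, coe_one]; norm_num)))

theorem half_ne_zero : half ≠ zero := fun h => by
  have := congrArg (fun x : MVChain 3 => (x.1 : ℝ)) h
  simp only [coe_zero, coe_half] at this
  norm_num at this

theorem half_ne_one : half ≠ one := fun h => by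
  have := congrArg (fun x : MVChain 3 => (x.1 : ℝ)) h
  simp only [coe_one, coe_half] at this
  norm_num at this

theorem neg_half : ∼ₘhalf = half := ext (by rw [coe_neg, coe_half]; norm_num)

theorem half_oplus_half : half ⊕ₘ half = one :=
  ext (by rw [coe_oplus, coe_half, coe_one]; norm_num)

end MVChain

/-- An algebra with elements `0, i, a, a ⊕ i, i*, 1` and the addition of `L₂ × L₃`. -/
theorem exists_mvEquiv_chain_prod {A : Type u} [MVAlgebra A] {i a : A} (I : MVIdeal A)
    (hiI : i ∈ I) (haI : a ∉ I) (hnI : ∼ₘa ∉ I) (hi : i ≠ zero) (hne : a ≠ ∼ₘa)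
    (hai : a ⊕ₘ i = ∼ₘa) (hii : i ⊕ₘ i = i) (haa : a ⊕ₘ a = ∼ₘi)
    (hall : ∀ x : A, x = zero ∨ x = i ∨ x = a ∨ x = ∼ₘa ∨ x = ∼ₘi ∨ x = one) :
    ∃ e : MVEquiv A (MVChain 2 × MVChain 3),
      e.toEquiv '' (I : Set A) = Set.univ ×ˢ {MVAlgebra.zero} := by
  classical
  have hia : i ⊕ₘ a = ∼ₘa := by rw [oplus_comm, hai]
  have hnn := neg_oplus_neg_self_of_oplus_self hii
  have hbi : ∼ₘa ⊕ₘ i = ∼ₘa := by rw [← hai, oplus_assoc, hii]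
  have hib : i ⊕ₘ ∼ₘa = ∼ₘa := by rw [oplus_comm, hbi]
  have hbb : ∼ₘa ⊕ₘ ∼ₘa = one := by
    nth_rw 1 [← hia]
    rw [oplus_assoc, oplus_neg_self, oplus_one]
  -- Here `a ≤ a ⊕ₘ a = ∼ₘi`, and `∼ₘi` is idempotent along with `i`.
  have hani : a ⊕ₘ ∼ₘi = ∼ₘi := by
    refine le_antisymm ?_ (by rw [oplus_comm]; exact le_oplus _ _)
    have := oplus_le_oplus (haa ▸ le_oplus a a : le a ∼ₘi) (le_refl ∼ₘi)
    rwa [hnn] at this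
  have hnia : ∼ₘi ⊕ₘ a = ∼ₘi := by rw [oplus_comm, hani]
  have hbni : ∼ₘa ⊕ₘ ∼ₘi = one := by rw [← hai, oplus_assoc, oplus_neg_self, oplus_one]
  have hnib : ∼ₘi ⊕ₘ ∼ₘa = one := by rw [oplus_comm, hbni]
  have h1 : (one : A) ∉ I := fun h => haI (I.mem_of_le' h (oplus_one _))
  have hniI : ∼ₘi ∉ I := fun h => h1 (by rw [← oplus_neg_self i]; exact I.oplus_mem' hiI h)
  have h0I : (zero : A) ∈ I := I.zero_mem'
  have hni1 : ∼ₘi ≠ one := fun h => hi (by rw [← MVAlgebra.neg_neg i, h, neg_one_eq_zero])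
  have hnb : ∼ₘi ≠ ∼ₘa := fun h => haI (neg_inj h ▸ hiI)
  have hb1 : ∼ₘa ≠ one := fun h => haI (by rw [← MVAlgebra.neg_neg a, h, neg_one_eq_zero]; exact h0I)
  have ha1 : a ≠ one := fun h => hnI (by rw [h, neg_one_eq_zero]; exact h0I)
  have hna : ∼ₘi ≠ a := fun h => hb1 (by rw [← hai, ← h, neg_oplus_self])
  -- Membership in `I` separates `0` and `i` from the other four elements.
  have e0 : ∀ {x : A}, x ∉ I → zero ≠ x := fun hx h => hx (h ▸ h0I)
  have ei : ∀ {x : A}, x ∉ I → i ≠ x := fun hx h => hx (h ▸ hiI)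
  have h2 := MVChain.zero_ne_one 2
  have h3 := MVChain.zero_ne_one 3
  have hh0 := MVChain.half_ne_zero
  have hh1 := MVChain.half_ne_one
  -- The dictionary is `(1, 0) ↦ i`, `(0, 1/2) ↦ a`, `(0, 1) ↦ ∼ₘi`; then `(1, 1/2)` goes to `i ⊕ₘ a
  -- = ∼ₘa`.
  let g : MVChain 2 × MVChain 3 → A := fun p =>
    (if p.1 = zero then zero else i) ⊕ₘ
      (if p.2 = zero then zero else if p.2 = one then ∼ₘi else a)
  have g00 : g (zero, zero) = zero := by simp [g, oplus_zero]
  have g10 : g (one, zero) = i := by simp [g, h2.symm, oplus_zero]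
  have g0h : g (zero, MVChain.half) = a := by simp [g, hh0, hh1, zero_oplus]
  have g1h : g (one, MVChain.half) = ∼ₘa := by simp [g, h2.symm, hh0, hh1, hia]
  have g01 : g (zero, one) = ∼ₘi := by simp [g, h3.symm, zero_oplus]
  have g11 : g (one, one) = one := by simp [g, h2.symm, h3.symm, oplus_neg_self]
  have hcases : ∀ {P : MVChain 2 × MVChain 3 → Prop}, P (zero, zero) → P (one, zero) →
      P (zero, MVChain.half) → P (one, MVChain.half) → P (zero, one) → P (one, one) →
      ∀ p, P p := by
    rintro P p00 p10 p0h p1h p01 p11 ⟨p, q⟩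
    rcases MVChain.eq_zero_or_eq_one p with rfl | rfl <;>
      rcases MVChain.eq_zero_or_half_or_one q with rfl | rfl | rfl <;> assumption
  have hinj : Function.Injective g := by
    intro p q
    revert p q
    refine hcases ?_ ?_ ?_ ?_ ?_ ?_ <;> refine hcases ?_ ?_ ?_ ?_ ?_ ?_ <;>
      simp [g00, g10, g0h, g1h, g01, g11, hi, hi.symm, e0 haI, (e0 haI).symm, e0 hnI,
        (e0 hnI).symm, e0 hniI, (e0 hniI).symm, e0 h1, (e0 h1).symm, ei haI, (ei haI).symm,
        ei hnI, (ei hnI).symm, ei hniI, (ei hniI).symm, ei h1, (ei h1).symm, hne, hne.symm,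
        hna, hna.symm, hnb, hnb.symm, hni1, hni1.symm, ha1, ha1.symm, hb1, hb1.symm]
  have hsurj : Function.Surjective g := by
    intro x
    rcases hall x with rfl | rfl | rfl | rfl | rfl | rfl
    exacts [⟨_, g00⟩, ⟨_, g10⟩, ⟨_, g0h⟩, ⟨_, g1h⟩, ⟨_, g01⟩, ⟨_, g11⟩]
  have hpl : ∀ (p p' : MVChain 2) (q q' : MVChain 3),
      ((p, q) : MVChain 2 × MVChain 3) ⊕ₘ (p', q') = (p ⊕ₘ p', q ⊕ₘ q') := fun _ _ _ _ => rfl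
  have hng : ∀ (p : MVChain 2) (q : MVChain 3),
      ∼ₘ((p, q) : MVChain 2 × MVChain 3) = (∼ₘp, ∼ₘq) := fun _ _ => rfl
  have hplus : ∀ p q, g (p ⊕ₘ q) = g p ⊕ₘ g q := by
    refine hcases ?_ ?_ ?_ ?_ ?_ ?_ <;> refine hcases ?_ ?_ ?_ ?_ ?_ ?_ <;>
      simp only [hpl, zero_oplus, oplus_zero, one_oplus, oplus_one, MVChain.half_oplus_half,
        g00, g10, g0h, g1h, g01, g11, hai, hia, hii, haa, hnn, hbi, hib, hbb, hani, hnia, hbni,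
        hnib, neg_oplus_self, oplus_neg_self]
  have hneg : ∀ p, g ∼ₘp = ∼ₘ(g p) := by
    refine hcases ?_ ?_ ?_ ?_ ?_ ?_ <;>
      simp only [hng, neg_zero_eq_one, neg_one_eq_zero, MVChain.neg_half,
        g00, g10, g0h, g1h, g01, g11, MVAlgebra.neg_neg]
  refine ⟨MVEquiv.ofBijectiveSymm g ⟨hinj, hsurj⟩ hplus hneg g00, ?_⟩
  change (Equiv.ofBijective g ⟨hinj, hsurj⟩).symm '' _ = _
  rw [Equiv.image_symm_eq_preimage]
  ext p
  change g p ∈ I ↔ _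
  revert p
  refine hcases ?_ ?_ ?_ ?_ ?_ ?_ <;>
    simp [g00, g10, g0h, g1h, g01, g11, h0I, hiI, haI, hnI, hniI, h1, hh0, h3.symm]

end Chains

/-! ### Classes modulo an ideal and the girth of the graph. -/

section Graph

open MVAlgebra

namespace MVIdeal

variable {A : Type u} [MVAlgebra A] (I : MVIdeal A)

/-- The quotient map `A → A / I`. -/
def quot (x : A) : I.QuotientAlgebra := Quotient.mk I.setoid x

theorem quot_surjective : Function.Surjective I.quot := Quotient.mk_surjective

theorem quot_oplus (x y : A) : I.quot (x ⊕ₘ y) = I.quot x ⊕ₘ I.quot y := rfl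

theorem quot_neg (x : A) : I.quot ∼ₘx = ∼ₘ(I.quot x) := rfl

theorem quot_odot (x y : A) : I.quot (odot x y) = odot (I.quot x) (I.quot y) := rfl

theorem quot_eq_zero {x : A} : I.quot x = zero ↔ x ∈ I := by
  refine Quotient.eq.trans ?_
  change MVAlgebra.dist x zero ∈ I ↔ _
  have h₁ : odot x ∼ₘzero = x := by rw [odot_neg, oplus_zero, MVAlgebra.neg_neg]
  have h₂ : odot zero ∼ₘx = zero := odot_neg_eq_zero_iff.2 (zero_le x)
  rw [MVAlgebra.dist, h₁, h₂, oplus_zero]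

theorem odot_mem_iff {x y : A} : odot x y ∈ I ↔ odot (I.quot x) (I.quot y) = zero := by
  rw [← quot_odot, quot_eq_zero]

theorem quot_eq_one {x : A} : I.quot x = one ↔ ∼ₘx ∈ I := by
  rw [← quot_eq_zero, quot_neg]
  constructor
  · intro h
    rw [h, neg_one_eq_zero]
  · intro h
    rw [← MVAlgebra.neg_neg (I.quot x), h, neg_zero_eq_one]

variable {I}

theorem quot_oplus_of_mem (x : A) {j : A} (hj : j ∈ I) : I.quot (x ⊕ₘ j) = I.quot x := by
  rw [quot_oplus, I.quot_eq_zero.2 hj, oplus_zero]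

theorem quot_neg_neg_oplus_of_mem (x : A) {j : A} (hj : j ∈ I) :
    I.quot ∼ₘ(∼ₘx ⊕ₘ j) = I.quot x := by
  rw [quot_neg, quot_oplus_of_mem _ hj, quot_neg, MVAlgebra.neg_neg]

theorem exists_ne_zero_mem (hI0 : (I : Set A) ≠ {MVAlgebra.zero}) : ∃ i ∈ I, i ≠ zero := by
  by_contra! h
  exact hI0 (Set.eq_singleton_iff_unique_mem.2 ⟨I.zero_mem', h⟩)

/-- Every class modulo a nonzero ideal contains two comparable elements. -/
theorem exists_lt_of_quot_eq (hI0 : (I : Set A) ≠ {MVAlgebra.zero}) (q : I.QuotientAlgebra) :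
    ∃ a b : A, I.quot a = q ∧ I.quot b = q ∧ le a b ∧ a ≠ b := by
  obtain ⟨i, hi, hi0⟩ := exists_ne_zero_mem hI0
  obtain ⟨c, rfl⟩ := I.quot_surjective q
  -- If moving up by `i` fixes `c`, then moving down to `∼ₘ(∼ₘc ⊕ₘ i)` cannot, since `i ≠ 0`.
  by_cases h : c ⊕ₘ i = c
  · refine ⟨∼ₘ(∼ₘc ⊕ₘ i), c, quot_neg_neg_oplus_of_mem c hi, rfl, ?_, fun h' => hi0 ?_⟩
    · have := neg_le_neg (le_oplus ∼ₘc i)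
      rwa [MVAlgebra.neg_neg] at this
    · refine eq_zero_of_oplus_eq_of_neg_oplus_eq h ?_
      rw [← MVAlgebra.neg_neg (∼ₘc ⊕ₘ i), h']
  · exact ⟨c, c ⊕ₘ i, rfl, quot_oplus_of_mem c hi, le_oplus _ _, Ne.symm h⟩

/-- Distinctness is required in `A` only, so several corners may come from a single square-zero
class. -/
theorem egirth_eq_three_of_triangle {x y z : A} (hx : I.quot x ≠ zero) (hy : I.quot y ≠ zero)
    (hz : I.quot z ≠ zero) (hxy : x ≠ y) (hyz : y ≠ z) (hxz : x ≠ z)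
    (oxy : odot (I.quot x) (I.quot y) = zero) (oyz : odot (I.quot y) (I.quot z) = zero)
    (oxz : odot (I.quot x) (I.quot z) = zero) : I.zeroDivisorGraph.egirth = 3 := by
  classical
  rw [Ne, I.quot_eq_zero] at hx hy hz
  rw [← I.odot_mem_iff] at oxy oyz oxz
  let x' : I.zeroDivisorVertices := ⟨x, hx, y, hy, oxy⟩
  let y' : I.zeroDivisorVertices := ⟨y, hy, z, hz, oyz⟩
  let z' : I.zeroDivisorVertices := ⟨z, hz, y, hy, by rwa [odot_comm]⟩
  have h : I.zeroDivisorGraph.IsNClique 3 {x', y', z'} :=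
    SimpleGraph.is3Clique_triple_iff.2
      ⟨⟨fun h => hxy (congrArg Subtype.val h), oxy⟩, ⟨fun h => hxz (congrArg Subtype.val h), oxz⟩,
        ⟨fun h => hyz (congrArg Subtype.val h), oyz⟩⟩
  obtain ⟨u, w, hw, hl⟩ := SimpleGraph.is3Clique_iff_exists_cycle_length_three.1 ⟨_, h⟩
  refine _root_.le_antisymm ?_ SimpleGraph.three_le_egirth
  have := SimpleGraph.egirth_le_length hw
  rwa [hl] at this

/-- A square-zero class with another annihilating class gives a triangle. -/
theorem egirth_eq_three_of_odot_self (hI0 : (I : Set A) ≠ {MVAlgebra.zero})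
    {u y : I.QuotientAlgebra} (hu : u ≠ zero) (huu : odot u u = zero) (hy : y ≠ zero)
    (hyu : y ≠ u) (huy : odot u y = zero) : I.zeroDivisorGraph.egirth = 3 := by
  obtain ⟨a, b, rfl, hb, -, hab⟩ := exists_lt_of_quot_eq hI0 u
  obtain ⟨c, rfl⟩ := I.quot_surjective y
  exact egirth_eq_three_of_triangle hu (hb ▸ hu) hy hab
    (fun h => hyu (by rw [← hb, h])) (fun h => hyu (by rw [h])) (by rw [hb, huu])
    (by rw [hb, huy]) huy

/-- Idempotence gives `p ⊙ p = p`, so orthogonal nonzero classes are distinct and any lifts of them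
are too. -/
theorem egirth_eq_three_of_orthogonal {x y z : I.QuotientAlgebra}
    (hb : ∀ q : I.QuotientAlgebra, q ⊕ₘ q = q) (hx : x ≠ zero) (hy : y ≠ zero) (hz : z ≠ zero)
    (hxy : odot x y = zero) (hyz : odot y z = zero) (hxz : odot x z = zero) :
    I.zeroDivisorGraph.egirth = 3 := by
  have hne : ∀ {p q : I.QuotientAlgebra}, p ≠ zero → odot p q = zero → p ≠ q := by
    rintro p _ hp h rfl
    rw [odot, hb, MVAlgebra.neg_neg] at h
    exact hp h
  obtain ⟨a, rfl⟩ := I.quot_surjective x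
  obtain ⟨b, rfl⟩ := I.quot_surjective y
  obtain ⟨c, rfl⟩ := I.quot_surjective z
  exact egirth_eq_three_of_triangle hx hy hz (fun h => hne hx hxy (by rw [h]))
    (fun h => hne hy hyz (by rw [h])) (fun h => hne hx hxz (by rw [h])) hxy hyz hxz

/-- If `A / I` is the chain `{0, u, 1}` and the class `u` has only two elements, then `A` is
`L₂ × L₃`. -/
theorem exists_mvEquiv_of_class_eq_pair (hI0 : (I : Set A) ≠ {MVAlgebra.zero})
    {u : I.QuotientAlgebra} (hu : u ≠ zero) (hn : ∼ₘu = u)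
    (hall : ∀ q : I.QuotientAlgebra, q = zero ∨ q = u ∨ q = one) {a b : A} (ha : I.quot a = u)
    (hb : I.quot b = u) (hle : le a b) (hab : a ≠ b) (hcls : ∀ x, I.quot x = u → x = a ∨ x = b) :
    ∃ e : MVEquiv A (MVChain 2 × MVChain 3),
      e.toEquiv '' (I : Set A) = Set.univ ×ˢ {MVAlgebra.zero} := by
  -- Negation is an order-reversing bijection of the class `u`, so it swaps its two elements.
  have hna : ∼ₘa = b := by
    refine (hcls ∼ₘa (by rw [quot_neg, ha, hn])).resolve_left fun h => ?_
    have hnb := neg_le_neg hle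
    rw [h] at hnb
    rcases hcls ∼ₘb (by rw [quot_neg, hb, hn]) with h' | h'
    · exact hab (neg_inj (h.trans h'.symm))
    · rw [h'] at hnb
      exact hab (le_antisymm hle hnb)
  subst hna
  -- Adding `j` stays in the class and moves upwards, so its top element is fixed; a nonzero `j`
  -- must then move `a`.
  have hbj : ∀ j ∈ I, ∼ₘa ⊕ₘ j = ∼ₘa := by
    intro j hj
    refine (hcls (∼ₘa ⊕ₘ j) (by rw [quot_oplus_of_mem _ hj, hb])).resolve_left fun h => hab ?_
    have hba := le_oplus ∼ₘa j
    rw [h] at hba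
    exact le_antisymm hle hba
  have haj : ∀ j ∈ I, j ≠ zero → a ⊕ₘ j = ∼ₘa := by
    intro j hj hj0
    refine (hcls (a ⊕ₘ j) (by rw [quot_oplus_of_mem _ hj, ha])).resolve_left fun h => hj0 ?_
    exact eq_zero_of_oplus_eq_of_neg_oplus_eq h (hbj j hj)
  -- The element `a` alone determines every nonzero `j`, which forces `I = {0, i}`.
  have haa : ∀ j ∈ I, j ≠ zero → a ⊕ₘ a = ∼ₘj := by
    intro j hj hj0
    have hjb : le j ∼ₘa := le_iff.2 ⟨a, by rw [oplus_comm, haj j hj hj0]⟩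
    have h := neg_oplus_oplus ∼ₘj a
    unfold le at hjb
    rwa [MVAlgebra.neg_neg, oplus_comm j a, haj j hj hj0, MVAlgebra.neg_neg, oplus_comm ∼ₘa, hjb,
      neg_one_eq_zero, zero_oplus] at h
  obtain ⟨i, hi, hi0⟩ := exists_ne_zero_mem hI0
  have hmem : ∀ j ∈ I, j = zero ∨ j = i := fun j hj =>
    or_iff_not_imp_left.2 fun hj0 => neg_inj ((haa j hj hj0).symm.trans (haa i hi hi0))
  have hii : i ⊕ₘ i = i := (hmem _ (I.oplus_mem' hi hi)).resolve_left fun h =>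
    hi0 (eq_zero_of_le_zero (h ▸ le_oplus i i))
  refine exists_mvEquiv_chain_prod I hi (fun h => hu ?_) (fun h => hu ?_) hi0 hab
    (haj i hi hi0) hii (haa i hi hi0) fun x => ?_
  · rw [← ha, I.quot_eq_zero.2 h]
  · rw [← hb, I.quot_eq_zero.2 h]
  · rcases hall (I.quot x) with h | h | h
    · rcases hmem x (I.quot_eq_zero.1 h) with h | h <;> simp [h]
    · rcases hcls x h with h | h <;> simp [h]
    · rcases hmem _ (I.quot_eq_one.1 h) with h | h
      · have : x = one := by rw [← MVAlgebra.neg_neg x, h, neg_zero_eq_one]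
        simp [this]
      · have : x = ∼ₘi := by rw [← h, MVAlgebra.neg_neg]
        simp [this]

/-- If every class lies in `{0, u, 1}`, then either the class `u` carries a triangle or `A` is
`L₂ × L₃`. -/
theorem egirth_eq_three_of_three_classes (hI0 : (I : Set A) ≠ {MVAlgebra.zero})
    (hL : ¬ ∃ e : MVEquiv A (MVChain 2 × MVChain 3),
      e.toEquiv '' (I : Set A) = Set.univ ×ˢ {MVAlgebra.zero})
    {u : I.QuotientAlgebra} (hu : u ≠ zero) (huu : odot u u = zero) (hn : ∼ₘu = u)
    (hall : ∀ q : I.QuotientAlgebra, q = zero ∨ q = u ∨ q = one) :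
    I.zeroDivisorGraph.egirth = 3 := by
  obtain ⟨a, b, ha, hb, hle, hab⟩ := exists_lt_of_quot_eq hI0 u
  by_cases hcls : ∀ x, I.quot x = u → x = a ∨ x = b
  · exact absurd (exists_mvEquiv_of_class_eq_pair hI0 hu hn hall ha hb hle hab hcls) hL
  · push Not at hcls
    obtain ⟨c, hc, hca, hcb⟩ := hcls
    exact egirth_eq_three_of_triangle (ha ▸ hu) (hb ▸ hu) (hc ▸ hu) hab hcb.symm hca.symm
      (by rw [ha, hb, huu]) (by rw [hb, hc, huu]) (by rw [ha, hc, huu])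

theorem exists_ne_zero_ne_one (hcard : 3 ≤ Cardinal.mk I.QuotientAlgebra) :
    ∃ q : I.QuotientAlgebra, q ≠ zero ∧ q ≠ one := by
  classical
  by_contra! h
  have hu : (Set.univ : Set I.QuotientAlgebra) ⊆ {zero, one} := fun q _ =>
    or_iff_not_imp_left.2 (h q)
  have h₁ : Cardinal.mk I.QuotientAlgebra ≤ 2 := by
    rw [← Cardinal.mk_univ]
    refine (Cardinal.mk_le_mk_of_subset hu).trans ?_
    have := Cardinal.mk_insert_le (s := {(one : I.QuotientAlgebra)}) (a := zero)
    rw [Cardinal.mk_singleton, one_add_one_eq_two] at this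
    exact this
  exact absurd (hcard.trans h₁) (by norm_num)

theorem egirth_eq_three (hI0 : (I : Set A) ≠ {MVAlgebra.zero})
    (hcard : 3 ≤ Cardinal.mk I.QuotientAlgebra)
    (hL : ¬ ∃ e : MVEquiv A (MVChain 2 × MVChain 3),
      e.toEquiv '' (I : Set A) = Set.univ ×ˢ {MVAlgebra.zero})
    (hB : ¬ Nonempty (MVEquiv I.QuotientAlgebra BooleanFour)) :
    I.zeroDivisorGraph.egirth = 3 := by
  by_cases hb : ∀ q : I.QuotientAlgebra, q ⊕ₘ q = q
  · by_cases ho : ∃ x y z : I.QuotientAlgebra, x ≠ zero ∧ y ≠ zero ∧ z ≠ zero ∧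
        odot x y = zero ∧ odot y z = zero ∧ odot x z = zero
    · obtain ⟨x, y, z, hx, hy, hz, hxy, hyz, hxz⟩ := ho
      exact egirth_eq_three_of_orthogonal hb hx hy hz hxy hyz hxz
    · obtain ⟨q, hq0, hq1⟩ := exists_ne_zero_ne_one hcard
      exact absurd (nonempty_mvEquiv_booleanFour hq0 hq1 hb (eq_of_no_orthogonal ho hq0 hq1)) hB
  · push Not at hb
    obtain ⟨x, hx⟩ := hb
    obtain ⟨u, hu, huu⟩ := exists_ne_zero_odot_self_eq_zero hx
    by_cases h : ∀ y, odot u y = zero → y = zero ∨ y = u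
    · obtain ⟨hn, hall⟩ := eq_of_annihilator_subset hu huu h
      exact egirth_eq_three_of_three_classes hI0 hL hu huu hn hall
    · push Not at h
      obtain ⟨y, huy, hy, hyu⟩ := h
      exact egirth_eq_three_of_odot_self hI0 hu huu hy hyu huy

/-- Nonzero `I` is needed for the upper bound: each atom must have two lifts. The lower bound sends
a triangle to an orthogonal triple in `B₄`. -/
theorem egirth_eq_four (hI0 : (I : Set A) ≠ {MVAlgebra.zero})
    (e : MVEquiv I.QuotientAlgebra BooleanFour) : I.zeroDivisorGraph.egirth = 4 := by
  classical
  have hodot : ∀ x y, e.toEquiv (odot x y) = odot (e.toEquiv x) (e.toEquiv y) := fun x y => by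
    unfold odot
    exact (e.map_neg' _).trans (congrArg _ ((e.map_oplus' _ _).trans
      (congrArg₂ _ (e.map_neg' x) (e.map_neg' y))))
  have hz : ∀ {x}, e.toEquiv x = zero ↔ x = zero := fun {x} => by
    rw [← (e.map_zero' : e.toEquiv zero = zero)]
    exact e.toEquiv.injective.eq_iff
  have htri : ∀ x y z : I.zeroDivisorVertices, I.zeroDivisorGraph.Adj x y →
      I.zeroDivisorGraph.Adj y z → I.zeroDivisorGraph.Adj x z → False := by
    rintro ⟨x, hx⟩ ⟨y, hy⟩ ⟨z, hz'⟩ hxy hyz hxz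
    have hv : ∀ {x}, x ∈ I.zeroDivisorVertices → e.toEquiv (I.quot x) ≠ zero := fun hx h =>
      hx.1 (I.quot_eq_zero.1 (hz.1 h))
    have ho : ∀ {x y : A}, odot x y ∈ I →
        odot (e.toEquiv (I.quot x)) (e.toEquiv (I.quot y)) = zero := fun h => by
      rw [← hodot, hz, ← I.odot_mem_iff]
      exact h
    exact BooleanFour.no_orthogonal_triple (hv hx) (hv hy) (hv hz') (ho hxy.2) (ho hyz.2)
      (ho hxz.2)
  refine _root_.le_antisymm ?_ (SimpleGraph.le_egirth.2 fun a w hw => ?_)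
  · obtain ⟨p, hp⟩ := e.toEquiv.surjective ((true, false) : Bool × Bool)
    obtain ⟨q, hq⟩ := e.toEquiv.surjective ((false, true) : Bool × Bool)
    have hp0 : p ≠ zero := fun h => by
      rw [← hz, hp] at h
      exact absurd (congrArg Prod.fst h) (by decide)
    have hq0 : q ≠ zero := fun h => by
      rw [← hz, hq] at h
      exact absurd (congrArg Prod.snd h) (by decide)
    have hpq : odot p q = zero := by
      rw [← hz, hodot, hp, hq]
      exact BooleanFour.odot_mk _ _ _ _
    have hpne : p ≠ q := by
      rintro rfl
      exact absurd (congrArg Prod.fst (hp.symm.trans hq)) (by decide)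
    obtain ⟨x, x', hx, hx', -, hxx⟩ := exists_lt_of_quot_eq hI0 p
    obtain ⟨y, y', hy, hy', -, hyy⟩ := exists_lt_of_quot_eq hI0 q
    have hmem : ∀ {s t : A}, I.quot s = p → I.quot t = q → s ∉ I ∧ t ∉ I ∧ odot s t ∈ I ∧ s ≠ t := by
      rintro s t rfl rfl
      rw [← I.quot_eq_zero, ← I.quot_eq_zero, I.odot_mem_iff]
      exact ⟨hp0, hq0, hpq, fun h => hpne (by rw [h])⟩
    have hmem' : ∀ {s t : A}, I.quot s = p → I.quot t = q → odot t s ∈ I := fun hs ht => by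
      rw [odot_comm]; exact (hmem hs ht).2.2.1
    let vx : I.zeroDivisorVertices := ⟨x, (hmem hx hy).1, y, (hmem hx hy).2.1, (hmem hx hy).2.2.1⟩
    let vx' : I.zeroDivisorVertices :=
      ⟨x', (hmem hx' hy).1, y, (hmem hx' hy).2.1, (hmem hx' hy).2.2.1⟩
    let vy : I.zeroDivisorVertices := ⟨y, (hmem hx hy).2.1, x, (hmem hx hy).1, hmem' hx hy⟩
    let vy' : I.zeroDivisorVertices := ⟨y', (hmem hx hy').2.1, x, (hmem hx hy').1, hmem' hx hy'⟩
    have nxx : vx ≠ vx' := fun h => hxx (congrArg Subtype.val h)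
    have nyy : vy ≠ vy' := fun h => hyy (congrArg Subtype.val h)
    have nxy : vx ≠ vy := fun h => (hmem hx hy).2.2.2 (congrArg Subtype.val h)
    have nxy' : vx ≠ vy' := fun h => (hmem hx hy').2.2.2 (congrArg Subtype.val h)
    have mxy : vx' ≠ vy := fun h => (hmem hx' hy).2.2.2 (congrArg Subtype.val h)
    have mxy' : vx' ≠ vy' := fun h => (hmem hx' hy').2.2.2 (congrArg Subtype.val h)
    have a₁ : I.zeroDivisorGraph.Adj vx vy := ⟨nxy, (hmem hx hy).2.2.1⟩
    have a₂ : I.zeroDivisorGraph.Adj vy vx' := ⟨mxy.symm, hmem' hx' hy⟩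
    have a₃ : I.zeroDivisorGraph.Adj vx' vy' := ⟨mxy', (hmem hx' hy').2.2.1⟩
    have a₄ : I.zeroDivisorGraph.Adj vy' vx := ⟨nxy'.symm, hmem' hx hy'⟩
    -- The cycle alternates between lifts of the two atoms.
    let w : I.zeroDivisorGraph.Walk vx vx := .cons a₁ (.cons a₂ (.cons a₃ (.cons a₄ .nil)))
    have hw : w.IsCycle := by
      rw [SimpleGraph.Walk.cons_isCycle_iff]
      constructor
      · simp [SimpleGraph.Walk.cons_isPath_iff, nxx.symm, nyy, nxy.symm, nxy'.symm, mxy.symm,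
          mxy']
      · simp [nxx, nyy, nxy, nxy.symm, nxy', mxy.symm]
    exact SimpleGraph.egirth_le_length hw
  · have h3 := hw.three_le_length
    have hne : w.length ≠ 3 := fun hl => by
      obtain ⟨s, hs⟩ := SimpleGraph.is3Clique_iff_exists_cycle_length_three.2 ⟨a, w, hw, hl⟩
      obtain ⟨x, y, z, hxy, hxz, hyz, -⟩ := SimpleGraph.is3Clique_iff.1 hs
      exact htri x y z hxy hyz hxz
    exact_mod_cast (by omega : 4 ≤ w.length)

theorem egirth_eq_top (e : MVEquiv A (MVChain 2 × MVChain 3))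
    (he : e.toEquiv '' (I : Set A) = Set.univ ×ˢ {MVAlgebra.zero}) :
    I.zeroDivisorGraph.egirth = ⊤ := by
  classical
  have hmem : ∀ x, x ∈ I ↔ (e.toEquiv x).2 = zero := fun x => by
    have h : e.toEquiv x ∈ e.toEquiv '' (I : Set A) ↔ x ∈ (I : Set A) :=
      e.toEquiv.injective.mem_set_image
    rw [he] at h
    simpa using h.symm
  have hodot : ∀ x y, (e.toEquiv (odot x y)).2 = odot (e.toEquiv x).2 (e.toEquiv y).2 :=
    fun x y => by
      unfold odot
      exact congrArg Prod.snd ((e.map_neg' _).trans (congrArg _ ((e.map_oplus' _ _).trans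
        (congrArg₂ _ (e.map_neg' x) (e.map_neg' y)))))
  -- Second coordinate `0` means lying in `I`, and second coordinate `1` is orthogonal modulo `I`
  -- only to elements of `I`.
  have hhalf : ∀ x ∈ I.zeroDivisorVertices, (e.toEquiv x).2 = MVChain.half := by
    rintro x ⟨hx, y, hy, hxy⟩
    rw [hmem] at hx hy hxy
    rw [hodot] at hxy
    rcases MVChain.eq_zero_or_half_or_one (e.toEquiv x).2 with h | h | h
    · exact absurd h hx
    · exact h
    · rw [h, odot, neg_one_eq_zero, zero_oplus, MVAlgebra.neg_neg] at hxy
      exact absurd hxy hy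
  -- Only the `L₂` coordinate of a vertex is free, so there are at most two vertices.
  have hinj : Function.Injective
      fun x : I.zeroDivisorVertices => decide ((e.toEquiv (x : A)).1 = zero) := by
    intro x y h
    have h' : (e.toEquiv (x : A)).1 = zero ↔ (e.toEquiv (y : A)).1 = zero := by simpa using h
    refine Subtype.ext (e.toEquiv.injective (Prod.ext ?_ ?_))
    · rcases MVChain.eq_zero_or_eq_one (e.toEquiv (x : A)).1 with hx | hx <;>
        rcases MVChain.eq_zero_or_eq_one (e.toEquiv (y : A)).1 with hy | hy
      · rw [hx, hy]
      · rw [h'.1 hx, hx]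
      · rw [h'.2 hy, hy]
      · rw [hx, hy]
    · rw [hhalf x x.2, hhalf y y.2]
  rw [SimpleGraph.egirth_eq_top]
  intro v w hw
  -- The tail of a cycle's support has no repetitions and as many entries as the cycle has edges, so
  -- the length is at most 2.
  have hnd := (hw.support_nodup.map hinj).length_le_card
  rw [List.length_map, List.length_tail, SimpleGraph.Walk.length_support, Fintype.card_bool] at hnd
  have := hw.three_le_length
  omega

end MVIdeal

end Graph

theorem theorem5p15 {A : Type u} [MVAlgebra A] (I : MVIdeal A) (hI : I.IsProper)
    (hI0 : (I : Set A) ≠ {MVAlgebra.zero}) (hcard : 3 ≤ Cardinal.mk I.QuotientAlgebra) :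
    ((∃ e : MVEquiv A (MVChain 2 × MVChain 3),
        e.toEquiv '' (I : Set A) = Set.univ ×ˢ {MVAlgebra.zero}) →
      I.zeroDivisorGraph.egirth = ⊤) ∧
    (Nonempty (MVEquiv I.QuotientAlgebra BooleanFour) → I.zeroDivisorGraph.egirth = 4) ∧
    ((¬ ∃ e : MVEquiv A (MVChain 2 × MVChain 3),
        e.toEquiv '' (I : Set A) = Set.univ ×ˢ {MVAlgebra.zero}) →
      ¬ Nonempty (MVEquiv I.QuotientAlgebra BooleanFour) →
      I.zeroDivisorGraph.egirth = 3) := by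
  exact ⟨fun ⟨e, he⟩ => MVIdeal.egirth_eq_top e he, fun ⟨e⟩ => MVIdeal.egirth_eq_four hI0 e,
    fun hL hB => MVIdeal.egirth_eq_three hI0 hcard hL hB⟩
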